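/- Let $K$ be a field of characteristic $0$, let $\beta \in K$ and $n \ge 1$. For $1 \le r \le n$ consider the Macdonald operator $$D_n^r = t^{r(r-1)/2} \sum_{I \subseteq \{1,\dots,n\},\ |I| = r}\ \prod_{i \in I,\ j \notin I} \frac{t x_i - x_j}{x_i - x_j}\ \prod_{i \in I} T_{q,x_i}, \qquad (T_{q,x_i} f)(x_1,\dots,x_i,\dots,x_n) = f(x_1,\dots,q x_i,\dots,x_n),$$ with $q = \exp(h)$ and $t = \exp(\beta h)$, regarded as formal power series in $h$. For a rational function $f \in K(x_1,\dots,x_n)$, expand $D_n^r f \in K(x_1,\dots,x_n)[[h]]$ in powers of $h$, and let $D_n^r(h^k) f \in K(x_1,\dots,x_n)$ be the coefficient of $h^k$; this defines a $K$-linear operator $D_n^r(h^k)$ on $K(x_1,\dots,x_n)$. Then, on symmetric functions, $$\bigl[D_n^r(h^i),\, D_n^s(h^j)\bigr] = 0 \qquad (i, j \in \{0,1,2,3\},\ 1 \le r, s \le n),$$ that is, $D_n^r(h^i)\, D_n^s(h^j) f = D_n^s(h^j)\, D_n^r(h^i) f$ for every symmetric rational function $f \in K(x_1,\dots,x_n)$,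 in particular for every symmetric polynomial $f$. -/

import Mathlib

noncomputable section

namespace Macdonald

/-- The field `K(x₁, …, xₙ)` of rational functions in `n` variables. -/
abbrev RatFun (n : ℕ) (K : Type*) [Field K] : Type _ :=
  FractionRing (MvPolynomial (Fin n) K)

/-- The variable `xᵢ`, as a rational function. -/
def x {n : ℕ} (K : Type*) [Field K] (i : Fin n) : RatFun n K :=
  algebraMap (MvPolynomial (Fin n) K) (RatFun n K) (MvPolynomial.X i)

/-- The action of a permutation of the variables on rational functions, `xᵢ ↦ x_{σ i}`. -/
def permute {n : ℕ} {K : Type*} [Field K] (σ : Equiv.Perm (Fin n)) :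
    RatFun n K ≃+* RatFun n K :=
  IsFractionRing.ringEquivOfRingEquiv (MvPolynomial.renameEquiv K σ).toRingEquiv

/-- A rational function is symmetric if every permutation of the variables fixes it. -/
def IsSymmetric {n : ℕ} {K : Type*} [Field K] (f : RatFun n K) : Prop :=
  ∀ σ : Equiv.Perm (Fin n), permute σ f = f

/-- `q = exp(h)`, as a power series in `h` (with constant coefficients). -/
def qSeries (n : ℕ) (K : Type*) [Field K] [CharZero K] : PowerSeries (RatFun n K) :=
  PowerSeries.map (algebraMap K (RatFun n K)) (PowerSeries.exp K)

/-- `t = exp(β h)`, as a power series in `h` (with constant coefficients). -/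
def tSeries (n : ℕ) {K : Type*} [Field K] [CharZero K] (β : K) : PowerSeries (RatFun n K) :=
  PowerSeries.map (algebraMap K (RatFun n K)) (PowerSeries.rescale β (PowerSeries.exp K))

/-- The substitution `xᵢ ↦ q xᵢ` for `i ∈ I` (the other variables being kept) in a polynomial,
expanded in powers of `h`, where `q = exp(h)`. -/
def shiftPoly {n : ℕ} (K : Type*) [Field K] [CharZero K] (I : Finset (Fin n)) :
    MvPolynomial (Fin n) K →ₐ[K] PowerSeries (RatFun n K) :=
  MvPolynomial.aeval fun i =>
    if i ∈ I then qSeries n K * PowerSeries.C (x K i) else PowerSeries.C (x K i)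

theorem constantCoeff_shiftPoly {n : ℕ} (K : Type*) [Field K] [CharZero K]
    (I : Finset (Fin n)) (p : MvPolynomial (Fin n) K) :
    PowerSeries.constantCoeff (shiftPoly K I p) = algebraMap _ (RatFun n K) p := by
  induction p using MvPolynomial.induction_on with
  | C a =>
    rw [← MvPolynomial.algebraMap_eq, AlgHom.commutes, PowerSeries.algebraMap_apply,
      PowerSeries.constantCoeff_C, ← IsScalarTower.algebraMap_apply]
  | add p q hp hq => rw [map_add, map_add, map_add, hp, hq]
  | mul_X p i hp =>
    rw [map_mul, map_mul, map_mul, hp]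
    by_cases h : i ∈ I <;> simp [shiftPoly, qSeries, h, x]

theorem isUnit_shiftPoly {n : ℕ} (K : Type*) [Field K] [CharZero K] (I : Finset (Fin n))
    (p : nonZeroDivisors (MvPolynomial (Fin n) K)) :
    IsUnit (shiftPoly K I (p : MvPolynomial (Fin n) K)) := by
  rw [PowerSeries.isUnit_iff_constantCoeff, constantCoeff_shiftPoly]
  exact IsLocalization.map_units (RatFun n K) p

/-- The composite `∏_{i ∈ I} T_{q, xᵢ}` of the shift operators, where
`(T_{q, xᵢ} f)(x₁, …, xₙ) = f(x₁, …, q xᵢ, …, xₙ)` and `q = exp(h)`, expanded in powers of `h`: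
the unique extension of `shiftPoly` to rational functions. -/
def shift {n : ℕ} (K : Type*) [Field K] [CharZero K] (I : Finset (Fin n)) :
    RatFun n K →ₐ[K] PowerSeries (RatFun n K) :=
  IsLocalization.liftAlgHom (M := nonZeroDivisors (MvPolynomial (Fin n) K))
    (f := shiftPoly K I) (isUnit_shiftPoly K I)

/-- The Macdonald operator
`D_n^r = t^{r(r-1)/2} ∑_{|I| = r} ∏_{i ∈ I, j ∉ I} (t xᵢ - xⱼ) / (xᵢ - xⱼ) ∏_{i ∈ I} T_{q, xᵢ}`
with `q = exp(h)` and `t = exp(β h)`, expanded in powers of `h`. -/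
def D (n : ℕ) {K : Type*} [Field K] [CharZero K] (β : K) (r : ℕ) :
    RatFun n K →ₗ[K] PowerSeries (RatFun n K) :=
  ∑ I ∈ Finset.powersetCard r (Finset.univ : Finset (Fin n)),
    LinearMap.mulLeft K
        (tSeries n β ^ (r * (r - 1) / 2) *
          ∏ i ∈ I, ∏ j ∈ Iᶜ,
            (tSeries n β * PowerSeries.C (x K i) - PowerSeries.C (x K j)) *
              PowerSeries.C ((x K i - x K j)⁻¹)) ∘ₗ
      (shift K I).toLinearMap

/-- The `k`-th order `D_n^r(h^k)` of `D_n^r`: the coefficient of `h^k` in its expansion. -/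
def order (n : ℕ) {K : Type*} [Field K] [CharZero K] (β : K) (r k : ℕ) :
    RatFun n K →ₗ[K] RatFun n K where
  toFun f := PowerSeries.coeff k (D n β r f)
  map_add' f g := by simp
  map_smul' c f := by
    rw [map_smul, RingHom.id_apply, PowerSeries.coeff_smul]

end Macdonald

end

/-!
The operators `D_n^r` are `q`-difference operators whose coefficients involve `t = exp (β h)`, and
`D_n^r(h^k)` collects the terms of order `k` of their expansion. Commutation of the full operators
`D_n^r` and `D_n^s` only gives, for every `k`, the vanishing of the sum of the commutators
`[D_n^r(h^a), D_n^s(h^b)]` over `a + b = k`. For orders up to `3` the individual commutators can be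
separated, thanks to three facts.

* `DExt_D_comm`: the extended operators `D_n^r` and `D_n^s` commute. Sort the terms
  `(I, J)` of the composite by `I ∪ J` and `I ∩ J`. The part of the coefficient that depends on
  the way in which `I ∪ J` without `I ∩ J` is split into `I` without `J` and `J` without `I` is a
  product of `pairWeight`s, and the sum over the splittings with prescribed cardinalities is
  symmetric in these cardinalities. This is `sum_splitWeight_eq_zero`: as a function of one
  variable `z = x_p`, the difference of the two sums becomes, after multiplication by
  `3 (|P| - 1)` linear factors, a polynomial of degree at most `3 (|P| - 1)`; by induction on the
  set `P` of variables it vanishes at `0` and at all `x_k`, `q x_k` and `q⁻¹ x_k`, which is one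
  point more than the degree.
* `DExt_negParam_D`: `D_n^r` also commutes with `D_n^s` taken at `-h`. Passing to complements of
  subsets, `D_n^s` at `-h` is a power of `t` times `D_n^{n-s}` composed with the inverse of the
  simultaneous scaling `x_i ↦ q x_i` of all variables (`exists_negParam_D`), and this scaling
  commutes with everything, because the coefficients of the operators are homogeneous of degree
  zero.
* `order_zero_comm`, `order_one_comm`: the terms of order `0` are scalars, and those of order `1`
  are of the form `a • E + b` with constants `a`, `b`, where `E` is the Euler operator
  `∑ x_i ∂/∂x_i`, so both commute with all `D_n^s(h^k)`.

Let `c a b` be the commutator of `D_n^r(h^a)` and `D_n^s(h^b)`. The first two facts give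
`∑ c a b = 0` and `∑ (-1)^b c a b = 0` over `a + b = k`, and the third kills all `c a b` with
`a ≤ 1` or `b ≤ 1`. Then `k = 4` yields `c 2 2 = 0`, `k = 5` yields `c 2 3 ± c 3 2 = 0`, and
`k = 6` yields `c 2 4 ± c 3 3 + c 4 2 = 0`, hence `c 3 3 = 0`.
-/

noncomputable section

namespace Macdonald

/-! ### A symmetric sum over splittings of a set of variables -/

section SplitIdentity

variable {L ι : Type*} [Field L] [DecidableEq ι]

/-- The weight of an ordered pair of variables `a`, `b` that lie on different sides of a splitting.
It is the product of `(t a - b) / (a - b)` and of the same factor for the pair `b`, `q a`. -/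
def pairWeight (q t a b : L) : L :=
  ((t * a - b) * (t * b - q * a)) / ((a - b) * (b - q * a))

/-- The weight of a splitting of a set of variables into `A` and `B`: the product of the weights of
all pairs of a variable in `A` and a variable in `B`. -/
def splitWeight (q t : L) (x : ι → L) (A B : Finset ι) : L :=
  ∏ i ∈ A, ∏ j ∈ B, pairWeight q t (x i) (x j)

theorem splitWeight_insert_left (q t : L) (x : ι → L) {A B : Finset ι} {p : ι} (hp : p ∉ A) :
    splitWeight q t x (insert p A) B =
      splitWeight q t x A B * ∏ j ∈ B, pairWeight q t (x p) (x j) := by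
  rw [splitWeight, Finset.prod_insert hp, mul_comm, splitWeight]

theorem splitWeight_insert_right (q t : L) (x : ι → L) {A B : Finset ι} {p : ι} (hp : p ∉ B) :
    splitWeight q t x A (insert p B) =
      splitWeight q t x A B * ∏ i ∈ A, pairWeight q t (x i) (x p) := by
  simp only [splitWeight, Finset.prod_insert hp, Finset.prod_mul_distrib]
  rw [mul_comm]

/-- Splittings of `insert p P` are splittings of `P` with `p` added to one of the two parts. -/
theorem sum_powerset_insert_sdiff {M : Type*} [AddCommMonoid M] {P : Finset ι} {p : ι}
    (hp : p ∉ P) (F : Finset ι → Finset ι → M) :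
    ∑ A ∈ (insert p P).powerset, F A (insert p P \ A) =
      ∑ A ∈ P.powerset, (F (insert p A) (P \ A) + F A (insert p (P \ A))) := by
  rw [Finset.sum_powerset_insert hp, add_comm, ← Finset.sum_add_distrib]
  refine Finset.sum_congr rfl fun A hA => ?_
  have hpA : p ∉ A := fun h => hp (Finset.mem_powerset.1 hA h)
  rw [Finset.insert_sdiff_insert, Finset.insert_sdiff_of_notMem _ hpA,
    Finset.sdiff_insert_of_notMem hp]

/-- The common denominator contributed by a variable `a`, as a function of the variable `z`. -/
def denomFactor (q z a : L) : L := (z - a) * (a - q * z) * (z - q * a)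

/-- `pairWeight q t z a`, cleared of its denominators by `denomFactor q z a`. -/
def leftFactor (q t z a : L) : L := (t * z - a) * (t * a - q * z) * (z - q * a)

/-- `pairWeight q t a z`, cleared of its denominators by `denomFactor q z a`. -/
def rightFactor (q t z a : L) : L := (z - t * a) * (t * z - q * a) * (a - q * z)

theorem pairWeight_mul_denomFactor_left (q t : L) {z a : L} (h1 : z ≠ a) (h2 : a ≠ q * z) :
    pairWeight q t z a * denomFactor q z a = leftFactor q t z a := by
  have := sub_ne_zero.2 h1
  have := sub_ne_zero.2 h2
  rw [pairWeight, denomFactor, leftFactor, div_mul_eq_mul_div, div_eq_iff (mul_ne_zero ‹_› ‹_›)]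
  ring

theorem pairWeight_mul_denomFactor_right (q t : L) {z a : L} (h1 : z ≠ a) (h2 : z ≠ q * a) :
    pairWeight q t a z * denomFactor q z a = rightFactor q t z a := by
  have := sub_ne_zero.2 h1.symm
  have := sub_ne_zero.2 h2
  rw [pairWeight, denomFactor, rightFactor, div_mul_eq_mul_div, div_eq_iff (mul_ne_zero ‹_› ‹_›)]
  ring

/-- This symmetry makes the contributions of the variables other than `z` and `x k` independent of
the splitting when `z = q * x k` or `x k = q * z`. -/
theorem pairWeight_mul_right {q : L} (hq : q ≠ 0) (t a b : L) :
    pairWeight q t a (q * b) = pairWeight q t b a := by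
  rw [pairWeight, pairWeight,
    show (t * a - q * b) * (t * (q * b) - q * a) = q * ((t * b - a) * (t * a - q * b)) by ring,
    show (a - q * b) * (q * b - q * a) = q * ((b - a) * (a - q * b)) by ring,
    mul_div_mul_left _ _ hq]

/-- The sum over the splittings of `P`, together with a further variable `z` added to either
part, cleared of the denominators that involve `z`. The coefficient of a splitting is the value of
`e` at the cardinalities of its two parts, `z` included. -/
def clearedSum (q t : L) (x : ι → L) (P : Finset ι) (e : ℕ → ℕ → L) (z : L) : L :=
  ∑ A ∈ P.powerset, splitWeight q t x A (P \ A) *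
    (e (A.card + 1) (P \ A).card *
        ((∏ j ∈ P \ A, leftFactor q t z (x j)) * ∏ i ∈ A, denomFactor q z (x i)) +
      e A.card ((P \ A).card + 1) *
        ((∏ i ∈ A, rightFactor q t z (x i)) * ∏ j ∈ P \ A, denomFactor q z (x j)))

open Polynomial in
theorem exists_polynomial_clearedSum (q t : L) (x : ι → L) (P : Finset ι) (e : ℕ → ℕ → L) :
    ∃ N : L[X], N.natDegree ≤ 3 * P.card ∧ ∀ z, N.eval z = clearedSum q t x P e z := by
  let d : L → L[X] := fun a => (X - C a) * (C a - C q * X) * (X - C q * C a)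
  let l : L → L[X] := fun a => (C t * X - C a) * (C t * C a - C q * X) * (X - C q * C a)
  let r : L → L[X] := fun a => (X - C t * C a) * (C t * X - C q * C a) * (C a - C q * X)
  have hd : ∀ a, (d a).natDegree ≤ 3 := fun a => by simp only [d]; compute_degree
  have hl : ∀ a, (l a).natDegree ≤ 3 := fun a => by simp only [l]; compute_degree
  have hr : ∀ a, (r a).natDegree ≤ 3 := fun a => by simp only [r]; compute_degree
  have hprod : ∀ (g : L → L[X]), (∀ a, (g a).natDegree ≤ 3) → ∀ A : Finset ι,
      (∏ i ∈ A, g (x i)).natDegree ≤ 3 * A.card := fun g hg A =>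
    (natDegree_prod_le _ _).trans ((Finset.sum_le_card_nsmul _ _ 3 fun i _ => hg _).trans
      (by simp [mul_comm]))
  refine ⟨∑ A ∈ P.powerset, C (splitWeight q t x A (P \ A)) *
    (C (e (A.card + 1) (P \ A).card) * ((∏ j ∈ P \ A, l (x j)) * ∏ i ∈ A, d (x i)) +
      C (e A.card ((P \ A).card + 1)) * ((∏ i ∈ A, r (x i)) * ∏ j ∈ P \ A, d (x j))), ?_, ?_⟩
  · refine natDegree_sum_le_of_forall_le _ _ fun A hA => ?_
    have hc := Finset.card_sdiff_add_card_eq_card (Finset.mem_powerset.1 hA)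
    refine (natDegree_C_mul_le _ _).trans (natDegree_add_le_of_degree_le ?_ ?_) <;>
      refine (natDegree_C_mul_le _ _).trans (natDegree_mul_le.trans ?_)
    · have := hprod l hl (P \ A)
      have := hprod d hd A
      omega
    · have := hprod r hr A
      have := hprod d hd (P \ A)
      omega
  · intro z
    simp [clearedSum, eval_finsetSum, eval_prod, d, l, r, denomFactor, leftFactor, rightFactor]

/-- Clearing the denominators that involve one variable of a sum over splittings. -/
theorem prod_denomFactor_mul_sum {q t : L} {x : ι → L} {P : Finset ι} {p : ι} (hp : p ∉ P)
    (hinj : Function.Injective x) (h1 : ∀ i j, x i ≠ q * x j) (e : ℕ → ℕ → L) :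
    (∏ j ∈ P, denomFactor q (x p) (x j)) *
        ∑ A ∈ (insert p P).powerset,
          e A.card (insert p P \ A).card * splitWeight q t x A (insert p P \ A) =
      clearedSum q t x P e (x p) := by
  rw [sum_powerset_insert_sdiff hp fun A B => e A.card B.card * splitWeight q t x A B,
    Finset.mul_sum, clearedSum]
  refine Finset.sum_congr rfl fun A hA => ?_
  have hA' := Finset.mem_powerset.1 hA
  have hpA : p ∉ A := fun h => hp (hA' h)
  have hpB : p ∉ P \ A := fun h => hp (Finset.sdiff_subset h)
  have hne : ∀ j ∈ P, x p ≠ x j := fun j hj h => hp (hinj h ▸ hj)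
  rw [splitWeight_insert_left _ _ _ hpA, splitWeight_insert_right _ _ _ hpB,
    Finset.card_insert_of_notMem hpA, Finset.card_insert_of_notMem hpB,
    ← Finset.prod_sdiff hA',
    ← Finset.prod_congr rfl fun j hj => pairWeight_mul_denomFactor_left q t
      (hne j (Finset.sdiff_subset hj)) (h1 j p),
    ← Finset.prod_congr rfl fun j hj => pairWeight_mul_denomFactor_right q t
      (hne j (hA' hj)) (h1 p j),
    Finset.prod_mul_distrib, Finset.prod_mul_distrib]
  ring

theorem clearedSum_zero (q t : L) (x : ι → L) (P : Finset ι) (e : ℕ → ℕ → L) :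
    clearedSum q t x P e 0 = (∏ j ∈ P, q * x j ^ 3) *
      ∑ A ∈ P.powerset, (e (A.card + 1) (P \ A).card * t ^ (P \ A).card +
        e A.card ((P \ A).card + 1) * t ^ A.card) * splitWeight q t x A (P \ A) := by
  have hd : ∀ a, denomFactor q 0 a = q * a ^ 3 := fun a => by rw [denomFactor]; ring
  have hl : ∀ a, leftFactor q t 0 a = t * (q * a ^ 3) := fun a => by rw [leftFactor]; ring
  have hr : ∀ a, rightFactor q t 0 a = t * (q * a ^ 3) := fun a => by rw [rightFactor]; ring
  rw [clearedSum, Finset.mul_sum]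
  refine Finset.sum_congr rfl fun A hA => ?_
  rw [← Finset.prod_sdiff (Finset.mem_powerset.1 hA)]
  simp only [hd, hl, hr, Finset.prod_mul_distrib, Finset.prod_const]
  ring

/-- Expansion of `clearedSum` with respect to one of the variables, once the common denominator
of that variable vanishes. -/
theorem clearedSum_insert (q t : L) (x : ι → L) {P : Finset ι} {k : ι} (hk : k ∉ P)
    (e : ℕ → ℕ → L) {z : L} (hz : denomFactor q z (x k) = 0) :
    clearedSum q t x (insert k P) e z =
      ∑ A ∈ P.powerset, e (A.card + 1) ((P \ A).card + 1) * splitWeight q t x A (P \ A) *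
        (leftFactor q t z (x k) * ((∏ i ∈ A, pairWeight q t (x i) (x k) * denomFactor q z (x i)) *
            ∏ j ∈ P \ A, leftFactor q t z (x j)) +
          rightFactor q t z (x k) * ((∏ i ∈ A, rightFactor q t z (x i)) *
            ∏ j ∈ P \ A, pairWeight q t (x k) (x j) * denomFactor q z (x j))) := by
  rw [clearedSum, sum_powerset_insert_sdiff hk fun A B => splitWeight q t x A B *
    (e (A.card + 1) B.card *
        ((∏ j ∈ B, leftFactor q t z (x j)) * ∏ i ∈ A, denomFactor q z (x i)) +
      e A.card (B.card + 1) *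
        ((∏ i ∈ A, rightFactor q t z (x i)) * ∏ j ∈ B, denomFactor q z (x j)))]
  refine Finset.sum_congr rfl fun A hA => ?_
  have hA' := Finset.mem_powerset.1 hA
  have hkA : k ∉ A := fun h => hk (hA' h)
  have hkB : k ∉ P \ A := fun h => hk (Finset.sdiff_subset h)
  rw [splitWeight_insert_left _ _ _ hkA, splitWeight_insert_right _ _ _ hkB,
    Finset.card_insert_of_notMem hkA, Finset.card_insert_of_notMem hkB]
  simp only [Finset.prod_insert hkA, Finset.prod_insert hkB, hz, Finset.prod_mul_distrib]
  ring

/-- A sum over splittings whose coefficients are antisymmetric in the two cardinalities vanishes.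
Equivalently, the sum of the weights of all splittings into `a` and `b` variables is symmetric in
`a` and `b`. -/
theorem sum_splitWeight_eq_zero {q t : L} {x : ι → L} (hq : q ≠ 0) (hx : ∀ i, x i ≠ 0)
    (hinj : Function.Injective x) (h1 : ∀ i j, x i ≠ q * x j) (h2 : ∀ i j, x i ≠ q * (q * x j))
    (P : Finset ι) (e : ℕ → ℕ → L) (he0 : ∀ a, e a a = 0) (he : ∀ a b, e a b = -e b a) :
    ∑ A ∈ P.powerset, e A.card (P \ A).card * splitWeight q t x A (P \ A) = 0 := by
  induction P using Finset.strongInduction generalizing e with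
  | H P ih =>
  obtain rfl | ⟨p, hpP⟩ := P.eq_empty_or_nonempty
  · simp [he0]
  obtain ⟨Q, hpQ, rfl⟩ : ∃ Q, p ∉ Q ∧ insert p Q = P :=
    ⟨P.erase p, P.notMem_erase p, Finset.insert_erase hpP⟩
  have hQ : Q ⊂ insert p Q := Finset.ssubset_insert hpQ
  -- the induction hypothesis once `z` and `x k` have been placed on different sides
  have hrec : ∀ k ∈ Q, ∑ A ∈ (Q.erase k).powerset,
      e (A.card + 1) ((Q.erase k \ A).card + 1) * splitWeight q t x A (Q.erase k \ A) = 0 :=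
    fun k hk => ih _ ((Finset.erase_ssubset hk).trans hQ) (fun a b => e (a + 1) (b + 1))
      (fun a => he0 _) fun a b => he _ _
  have hzero : ∀ z, z = 0 ∨ (∃ k ∈ Q, z = x k) ∨ (∃ k ∈ Q, z = q * x k) ∨
      (∃ k ∈ Q, z = q⁻¹ * x k) → clearedSum q t x Q e z = 0 := by
    rintro z (rfl | ⟨k, hk, rfl⟩ | ⟨k, hk, rfl⟩ | ⟨k, hk, rfl⟩)
    · rw [clearedSum_zero, ih Q hQ (fun a b => e (a + 1) b * t ^ b + e a (b + 1) * t ^ a)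
        (fun a => by rw [he (a + 1) a]; ring)
        (fun a b => by rw [he (a + 1) b, he a (b + 1)]; ring), mul_zero]
    -- at `z = x k` the terms with `z` and `x k` on different sides cancel in pairs
    · have hne : ∀ l ∈ Q.erase k, x k ≠ x l := fun l hl h =>
        Finset.ne_of_mem_erase hl (hinj h).symm
      rw [← Finset.insert_erase hk, clearedSum_insert _ _ _ (Q.notMem_erase k) _
        (by simp [denomFactor])]
      refine Finset.sum_eq_zero fun A hA => ?_
      have hA' := Finset.mem_powerset.1 hA
      rw [Finset.prod_congr rfl fun j hj => pairWeight_mul_denomFactor_left q t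
          (hne j (Finset.sdiff_subset hj)) (h1 j k),
        Finset.prod_congr rfl fun j hj => pairWeight_mul_denomFactor_right q t
          (hne j (hA' hj)) (h1 k j),
        show rightFactor q t (x k) (x k) = -leftFactor q t (x k) (x k) by
          rw [leftFactor, rightFactor]; ring]
      ring
    -- at `z = q * x k` only the terms with `z` on the right and `x k` on the left survive, and the
    -- factors of `z` and `x k` come out of the sum
    · have hne : ∀ l ∈ Q.erase k, q * x k ≠ q * x l := fun l hl h =>
        Finset.ne_of_mem_erase hl (hinj (mul_left_cancel₀ hq h)).symm
      rw [← Finset.insert_erase hk, clearedSum_insert _ _ _ (Q.notMem_erase k) _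
        (by simp [denomFactor])]
      have hl : leftFactor q t (q * x k) (x k) = 0 := by simp [leftFactor]
      rw [← mul_zero (rightFactor q t (q * x k) (x k) * ∏ j ∈ Q.erase k,
        pairWeight q t (x k) (x j) * denomFactor q (q * x k) (x j)), ← hrec k hk, Finset.mul_sum]
      refine Finset.sum_congr rfl fun A hA => ?_
      have hA' := Finset.mem_powerset.1 hA
      rw [← Finset.prod_sdiff hA', hl, ← Finset.prod_congr rfl fun j hj =>
        pairWeight_mul_denomFactor_right q t (h1 j k).symm (hne j (hA' hj))]
      simp only [pairWeight_mul_right hq]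
      ring
    -- at `x k = q * z` only the terms with `z` on the left and `x k` on the right survive
    · have hqk : q * (q⁻¹ * x k) = x k := mul_inv_cancel_left₀ hq _
      have hne : ∀ l ∈ Q.erase k, x l ≠ q * (q⁻¹ * x k) := fun l hl h =>
        Finset.ne_of_mem_erase hl (hinj (h.trans hqk))
      have hne' : ∀ l, q⁻¹ * x k ≠ x l := fun l h => h1 k l (by rw [← h, hqk])
      rw [← Finset.insert_erase hk, clearedSum_insert _ _ _ (Q.notMem_erase k) _
        (by simp [denomFactor, hqk])]
      have hr : rightFactor q t (q⁻¹ * x k) (x k) = 0 := by simp [rightFactor, hqk]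
      rw [← mul_zero (leftFactor q t (q⁻¹ * x k) (x k) * ∏ j ∈ Q.erase k,
        pairWeight q t (x j) (x k) * denomFactor q (q⁻¹ * x k) (x j)), ← hrec k hk,
        Finset.mul_sum]
      refine Finset.sum_congr rfl fun A hA => ?_
      have hA' := Finset.mem_powerset.1 hA
      rw [← Finset.prod_sdiff hA', hr, ← Finset.prod_congr rfl fun j hj =>
        pairWeight_mul_denomFactor_left q t (hne' j) (hne j (Finset.sdiff_subset hj))]
      have hw : ∀ j, pairWeight q t (q⁻¹ * x k) (x j) = pairWeight q t (x j) (x k) := fun j => by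
        rw [← pairWeight_mul_right hq, hqk]
      simp only [hw]
      ring
  obtain ⟨N, hdeg, hN⟩ := exists_polynomial_clearedSum q t x Q e
  classical
  have hN0 : N = 0 := by
    -- the `3 * Q.card + 1` roots
    let f : Option (Q × Fin 3) → L := fun o =>
      o.elim 0 fun y => ![x y.1, q * x y.1, q⁻¹ * x y.1] y.2
    have hfinj : Function.Injective f := by
      have hne : ∀ k l, x k ≠ q⁻¹ * x l := fun k l h =>
        h1 l k (by rw [h, mul_inv_cancel_left₀ hq])
      have hne' : ∀ k l, q * x k ≠ q⁻¹ * x l := fun k l h =>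
        h2 l k (by rw [h, mul_inv_cancel_left₀ hq])
      rintro (_ | ⟨⟨k, hk⟩, a⟩) (_ | ⟨⟨l, hl⟩, b⟩) h
      · rfl
      · fin_cases b <;> simp [f, hx, hq, eq_comm] at h
      · fin_cases a <;> simp [f, hx, hq] at h
      · fin_cases a <;> fin_cases b <;>
          simp [f, hq, hinj.eq_iff, h1, (h1 _ _).symm, hne, (hne _ _).symm, hne',
            (hne' _ _).symm] at h ⊢ <;> exact h
    refine Polynomial.eq_zero_of_natDegree_lt_card_of_eval_eq_zero N hfinj (fun o => ?_) ?_
    · rw [hN]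
      refine hzero _ ?_
      rcases o with _ | ⟨⟨k, hk⟩, a⟩
      · exact Or.inl rfl
      · fin_cases a
        · exact Or.inr (Or.inl ⟨k, hk, rfl⟩)
        · exact Or.inr (Or.inr (Or.inl ⟨k, hk, rfl⟩))
        · exact Or.inr (Or.inr (Or.inr ⟨k, hk, rfl⟩))
    · simp only [Fintype.card_option, Fintype.card_prod, Fintype.card_coe, Fintype.card_fin]
      omega
  have hfin := prod_denomFactor_mul_sum (t := t) hpQ hinj h1 e
  rw [← hN, hN0, Polynomial.eval_zero] at hfin
  refine (mul_eq_zero.1 hfin).resolve_left (Finset.prod_ne_zero_iff.2 fun j hj => ?_)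
  exact mul_ne_zero (mul_ne_zero (sub_ne_zero.2 fun h => hpQ (hinj h ▸ hj))
    (sub_ne_zero.2 (h1 _ _))) (sub_ne_zero.2 (h1 _ _))

end SplitIdentity

/-! ### Extending operators to power series in `h` -/

section Extension

open PowerSeries Finset.HasAntidiagonal

variable {K R : Type*} [CommRing K] [CommRing R] [Algebra K R]

/-- The `h`-linear and `h`-adically continuous extension to `R⟦X⟧` of a linear map `Φ` from `R` to
`R⟦X⟧`, where the variable of the power series is `h`: it maps `∑ f_b h^b` to `∑ Φ(f_b) h^b`. -/
def hExtend (Φ : R →ₗ[K] R⟦X⟧) : R⟦X⟧ →ₗ[K] R⟦X⟧ where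
  toFun φ := PowerSeries.mk fun k =>
    ∑ ab ∈ antidiagonal k, coeff ab.1 (Φ (coeff ab.2 φ))
  map_add' φ ψ := by
    ext k
    simp [Finset.sum_add_distrib]
  map_smul' c φ := by
    ext k
    simp [Finset.smul_sum]

theorem coeff_hExtend (Φ : R →ₗ[K] R⟦X⟧) (φ : R⟦X⟧) (k : ℕ) :
    coeff k (hExtend Φ φ) = ∑ ab ∈ antidiagonal k, coeff ab.1 (Φ (coeff ab.2 φ)) := by
  simp [hExtend]

theorem hExtend_C (Φ : R →ₗ[K] R⟦X⟧) (f : R) : hExtend Φ (C f) = Φ f := by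
  ext k
  rw [coeff_hExtend, Finset.sum_eq_single (k, 0)]
  · simp
  · rintro ⟨a, b⟩ hab hne
    have hb : b ≠ 0 := by
      rintro rfl
      simp_all
    simp [coeff_C, hb]
  · simp

theorem hExtend_sum {α : Type*} (s : Finset α) (Φ : α → R →ₗ[K] R⟦X⟧) (φ : R⟦X⟧) :
    hExtend (∑ i ∈ s, Φ i) φ = ∑ i ∈ s, hExtend (Φ i) φ := by
  ext k
  simp only [coeff_hExtend, map_sum, LinearMap.sum_apply]
  rw [Finset.sum_comm]

theorem sum_antidiagonal_assoc {M : Type*} [AddCommMonoid M] (F : ℕ → ℕ → ℕ → M) (k : ℕ) :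
    ∑ ab ∈ antidiagonal k, ∑ cd ∈ antidiagonal ab.1, F cd.1 cd.2 ab.2 =
      ∑ ab ∈ antidiagonal k, ∑ cd ∈ antidiagonal ab.2, F ab.1 cd.1 cd.2 := by
  rw [Finset.sum_sigma', Finset.sum_sigma']
  refine Finset.sum_nbij' (fun y => ⟨(y.2.1, y.2.2 + y.1.2), (y.2.2, y.1.2)⟩)
    (fun y => ⟨(y.1.1 + y.2.1, y.2.2), (y.1.1, y.2.1)⟩) ?_ ?_ ?_ ?_ ?_ <;>
    rintro ⟨⟨a, b⟩, ⟨c, d⟩⟩ h <;>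
    simp only [Finset.mem_sigma, mem_antidiagonal] at h ⊢ <;>
    grind

theorem sum_antidiagonal_exchange {M : Type*} [AddCommMonoid M] (F : ℕ → ℕ → ℕ → ℕ → M)
    (k : ℕ) :
    ∑ ab ∈ antidiagonal k, ∑ cd ∈ antidiagonal ab.1,
        ∑ gh ∈ antidiagonal ab.2, F cd.1 cd.2 gh.1 gh.2 =
      ∑ ab ∈ antidiagonal k, ∑ cd ∈ antidiagonal ab.1,
        ∑ gh ∈ antidiagonal ab.2, F cd.1 gh.1 cd.2 gh.2 := by
  simp only [Finset.sum_sigma']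
  refine Finset.sum_nbij'
    (fun y => ⟨(y.2.1.1 + y.2.2.1, y.2.1.2 + y.2.2.2), (y.2.1.1, y.2.2.1), (y.2.1.2, y.2.2.2)⟩)
    (fun y => ⟨(y.2.1.1 + y.2.2.1, y.2.1.2 + y.2.2.2), (y.2.1.1, y.2.2.1), (y.2.1.2, y.2.2.2)⟩)
    ?_ ?_ ?_ ?_ ?_ <;>
    rintro ⟨⟨a, b⟩, ⟨c, d⟩, ⟨e, f⟩⟩ h <;>
    simp only [Finset.mem_sigma, mem_antidiagonal] at h ⊢ <;>
    grind

theorem hExtend_mulLeft_comp (g : R⟦X⟧) (Φ : R →ₗ[K] R⟦X⟧) (φ : R⟦X⟧) :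
    hExtend (LinearMap.mulLeft K g ∘ₗ Φ) φ = g * hExtend Φ φ := by
  ext k
  simp only [coeff_hExtend, coeff_mul, LinearMap.comp_apply, LinearMap.mulLeft_apply,
    Finset.mul_sum]
  exact sum_antidiagonal_assoc (fun a b c => coeff a g * coeff b (Φ (coeff c φ))) k

theorem hExtend_hExtend (Φ Ψ : R →ₗ[K] R⟦X⟧) (φ : R⟦X⟧) :
    hExtend Φ (hExtend Ψ φ) = hExtend (hExtend Φ ∘ₗ Ψ) φ := by
  ext k
  simp only [coeff_hExtend, map_sum, LinearMap.comp_apply]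
  exact (sum_antidiagonal_assoc (fun a b c => coeff a (Φ (coeff b (Ψ (coeff c φ))))) k).symm

theorem hExtend_mul (T : R →ₐ[K] R⟦X⟧) (φ ψ : R⟦X⟧) :
    hExtend T.toLinearMap (φ * ψ) = hExtend T.toLinearMap φ * hExtend T.toLinearMap ψ := by
  ext k
  simp only [coeff_hExtend, coeff_mul, map_sum, AlgHom.toLinearMap_apply, map_mul,
    Finset.sum_mul_sum]
  simp_rw [Finset.sum_comm (s := antidiagonal (Prod.snd _))]
  exact sum_antidiagonal_exchange
    (fun a b c d => coeff a (T (coeff c φ)) * coeff b (T (coeff d ψ))) k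

/-- The extension `hExtend` of an algebra homomorphism, as an algebra homomorphism. -/
def hExtendAlg (T : R →ₐ[K] R⟦X⟧) : R⟦X⟧ →ₐ[K] R⟦X⟧ :=
  AlgHom.ofLinearMap (hExtend T.toLinearMap)
    (by rw [← map_one (C (R := R)), hExtend_C, AlgHom.toLinearMap_apply, map_one, map_one])
    (hExtend_mul T)

theorem hExtendAlg_apply (T : R →ₐ[K] R⟦X⟧) (φ : R⟦X⟧) :
    hExtendAlg T φ = hExtend T.toLinearMap φ := rfl

theorem hExtendAlg_C (T : R →ₐ[K] R⟦X⟧) (f : R) : hExtendAlg T (C f) = T f := hExtend_C _ f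

theorem hExtendAlg_map_algebraMap (T : R →ₐ[K] R⟦X⟧) (φ : K⟦X⟧) :
    hExtendAlg T (PowerSeries.map (algebraMap K R) φ) = PowerSeries.map (algebraMap K R) φ := by
  ext k
  rw [hExtendAlg_apply, coeff_hExtend, Finset.sum_eq_single (0, k)]
  · simp [PowerSeries.algebraMap_apply]
  · rintro ⟨a, b⟩ hab hne
    have ha : a ≠ 0 := by
      rintro rfl
      simp_all
    simp [PowerSeries.algebraMap_apply, coeff_C, ha]
  · simp

/-- The extension is linear over power series with coefficients in `K`. -/
theorem hExtend_map_algebraMap_mul (Φ : R →ₗ[K] R⟦X⟧) (φ : K⟦X⟧) (ψ : R⟦X⟧) :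
    hExtend Φ (PowerSeries.map (algebraMap K R) φ * ψ) =
      PowerSeries.map (algebraMap K R) φ * hExtend Φ ψ := by
  have h : ∀ (a : K) (f : R), algebraMap K R a * f = a • f := fun a f =>
    (Algebra.smul_def a f).symm
  ext k
  simp only [coeff_hExtend, coeff_mul, coeff_map, map_sum, h, map_smul, PowerSeries.coeff_smul,
    Finset.smul_sum]
  rw [← sum_antidiagonal_assoc (fun a b c => coeff b φ • coeff a (Φ (coeff c ψ))),
    ← sum_antidiagonal_assoc (fun a b c => coeff a φ • coeff b (Φ (coeff c ψ)))]
  refine Finset.sum_congr rfl fun ab _ => ?_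
  rw [← Finset.Nat.sum_antidiagonal_swap]
  rfl

end Extension

/-! ### The Macdonald operators commute -/

section Commutation

open PowerSeries Finset.HasAntidiagonal

variable {n : ℕ} {K : Type*} [Field K]

theorem x_ne_zero (i : Fin n) : x K i ≠ 0 :=
  (map_ne_zero_iff _ (IsFractionRing.injective _ _)).2 (MvPolynomial.X_ne_zero i)

theorem x_injective : Function.Injective (x (n := n) K) :=
  (IsFractionRing.injective _ _).comp (MvPolynomial.X_injective)

theorem algebraMap_fractionRing_injective :
    Function.Injective (algebraMap (RatFun n K)⟦X⟧ (FractionRing (RatFun n K)⟦X⟧)) :=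
  IsFractionRing.injective _ _

theorem RatFun.algHom_ext {A : Type*} [CommRing A] [Algebra K A] {f g : RatFun n K →ₐ[K] A}
    (h : ∀ i, f (x K i) = g (x K i)) : f = g := by
  refine IsLocalization.algHom_ext (nonZeroDivisors (MvPolynomial (Fin n) K)) ?_
  exact MvPolynomial.algHom_ext h

variable [CharZero K]

theorem constantCoeff_qSeries : constantCoeff (qSeries n K) = 1 := by
  simp [qSeries]

theorem coeff_one_qSeries : coeff 1 (qSeries n K) = 1 := by
  simp [qSeries, coeff_exp]

theorem shift_x (I : Finset (Fin n)) (i : Fin n) :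
    shift K I (x K i) = if i ∈ I then qSeries n K * C (x K i) else C (x K i) := by
  rw [shift, x, IsLocalization.liftAlgHom_apply, IsLocalization.lift_eq]
  simp [shiftPoly, x]

/-- The shift `∏_{i ∈ I} T_{q, xᵢ}`, extended to power series in `h`. -/
def shiftExt (K : Type*) [Field K] [CharZero K] (I : Finset (Fin n)) :
    (RatFun n K)⟦X⟧ →ₐ[K] (RatFun n K)⟦X⟧ :=
  hExtendAlg (shift K I)

theorem shiftExt_C (I : Finset (Fin n)) (f : RatFun n K) :
    shiftExt K I (C f) = shift K I f := hExtendAlg_C _ f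

theorem shiftExt_qSeries (I : Finset (Fin n)) :
    shiftExt K I (qSeries n K) = qSeries n K := hExtendAlg_map_algebraMap _ _

theorem shiftExt_tSeries (I : Finset (Fin n)) (β : K) :
    shiftExt K I (tSeries n β) = tSeries n β := hExtendAlg_map_algebraMap _ _

/-- A composite of two shifts only depends on how often each variable is shifted. -/
theorem shiftExt_shift (I J : Finset (Fin n)) (f : RatFun n K) :
    shiftExt K I (shift K J f) = shiftExt K (I ∪ J) (shift K (I ∩ J) f) := by
  suffices h : (shiftExt K I).comp (shift K J) = (shiftExt K (I ∪ J)).comp (shift K (I ∩ J)) from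
    DFunLike.congr_fun h f
  refine RatFun.algHom_ext fun i => ?_
  by_cases hi : i ∈ I <;> by_cases hj : i ∈ J <;>
    simp [shift_x, shiftExt_C, shiftExt_qSeries, hi, hj]

/-- The product `∏_{i ∈ I, j ∉ I} (t xᵢ - xⱼ) / (xᵢ - xⱼ)`, expanded in powers of `h`. -/
def shiftCoeff (β : K) (I : Finset (Fin n)) : (RatFun n K)⟦X⟧ :=
  ∏ i ∈ I, ∏ j ∈ Iᶜ, (tSeries n β * C (x K i) - C (x K j)) * C ((x K i - x K j)⁻¹)

/-- The Macdonald operator `D_n^r`, extended to power series in `h`. -/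
def DExt (n : ℕ) {K : Type*} [Field K] [CharZero K] (β : K) (r : ℕ) :
    (RatFun n K)⟦X⟧ →ₗ[K] (RatFun n K)⟦X⟧ :=
  hExtend (D n β r)

theorem D_apply (β : K) (r : ℕ) (f : RatFun n K) :
    D n β r f = tSeries n β ^ (r * (r - 1) / 2) *
      ∑ I ∈ Finset.powersetCard r Finset.univ, shiftCoeff β I * shift K I f := by
  simp [D, shiftCoeff, Finset.mul_sum]

theorem DExt_apply (β : K) (r : ℕ) (φ : (RatFun n K)⟦X⟧) :
    DExt n β r φ = tSeries n β ^ (r * (r - 1) / 2) *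
      ∑ I ∈ Finset.powersetCard r Finset.univ, shiftCoeff β I * shiftExt K I φ := by
  simp only [DExt, D, hExtend_sum, hExtend_mulLeft_comp, Finset.mul_sum, shiftExt,
    hExtendAlg_apply, shiftCoeff, mul_assoc]

theorem coeff_DExt_D (β : K) (r s k : ℕ) (f : RatFun n K) :
    coeff k (DExt n β r (D n β s f)) =
      ∑ ab ∈ antidiagonal k, order n β r ab.1 (order n β s ab.2 f) :=
  coeff_hExtend _ _ _

theorem DExt_eq (β : K) (r : ℕ) : DExt n β r = hExtend (D n β r) := rfl

/-- The factor `(t a - b) / (a - b)` of the coefficients of the Macdonald operators. -/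
def crossFactor {L : Type*} [Field L] (t a b : L) : L := (t * a - b) / (a - b)

/-- The product of the factors `crossFactor` over all pairs in `A × B`. -/
def crossProd {L ι : Type*} [Field L] (t : L) (u v : ι → L) (A B : Finset ι) : L :=
  ∏ i ∈ A, ∏ j ∈ B, crossFactor t (u i) (v j)

section crossProd

variable {L ι : Type*} [Field L]

theorem crossProd_union_left [DecidableEq ι] (t : L) (u v : ι → L) {A A' : Finset ι}
    (h : Disjoint A A') (B : Finset ι) :
    crossProd t u v (A ∪ A') B = crossProd t u v A B * crossProd t u v A' B :=
  Finset.prod_union h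

theorem crossProd_union_right [DecidableEq ι] (t : L) (u v : ι → L) (A : Finset ι) {B B' : Finset ι}
    (h : Disjoint B B') :
    crossProd t u v A (B ∪ B') = crossProd t u v A B * crossProd t u v A B' := by
  simp only [crossProd, Finset.prod_union h, Finset.prod_mul_distrib]

theorem crossProd_congr {t : L} {u v u' v' : ι → L} {A B : Finset ι}
    (hu : ∀ i ∈ A, u i = u' i) (hv : ∀ j ∈ B, v j = v' j) :
    crossProd t u v A B = crossProd t u' v' A B :=
  Finset.prod_congr rfl fun i hi => Finset.prod_congr rfl fun j hj => by rw [hu i hi, hv j hj]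

theorem crossFactor_mul_left {q : L} (hq : q ≠ 0) (t a b : L) :
    crossFactor t (q * a) (q * b) = crossFactor t a b := by
  rw [crossFactor, crossFactor, show t * (q * a) - q * b = q * (t * a - b) by ring, ← mul_sub,
    mul_div_mul_left _ _ hq]

theorem crossProd_mul_crossProd (q t : L) (y : ι → L) (A B : Finset ι) :
    crossProd t y y A B * crossProd t y (fun i => q * y i) B A = splitWeight q t y A B := by
  rw [crossProd, crossProd, Finset.prod_comm (s := B), ← Finset.prod_mul_distrib, splitWeight]
  refine Finset.prod_congr rfl fun i _ => ?_
  rw [← Finset.prod_mul_distrib]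
  refine Finset.prod_congr rfl fun j _ => ?_
  rw [crossFactor, crossFactor, pairWeight, div_mul_div_comm]

/-- The part of the coefficient of the composite of two Macdonald operators that only depends on the
set `M` of variables shifted twice, the set `P` of those shifted once and the set `Z` of those that
are kept. -/
def commonFactor (q t : L) (y : ι → L) (M P Z : Finset ι) : L :=
  crossProd t y y M P * crossProd t y y M Z * crossProd t (fun i => q * y i) y M Z *
    crossProd t y y P Z

/-- The coefficient of the term of the composite of two Macdonald operators given by the subsets
`M ∪ A` and `M ∪ B`, where `Z` is the complement of the union. -/
theorem crossProd_splitting [DecidableEq ι] {q : L} (hq : q ≠ 0) (t : L) (y : ι → L)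
    {M A B Z : Finset ι} (hMA : Disjoint M A) (hMB : Disjoint M B) (hAB : Disjoint A B)
    (hAZ : Disjoint A Z) (hBZ : Disjoint B Z) (hMZ : Disjoint M Z) :
    crossProd t y y (M ∪ A) (B ∪ Z) *
        crossProd t (fun i => if i ∈ M ∪ A then q * y i else y i)
          (fun i => if i ∈ M ∪ A then q * y i else y i) (M ∪ B) (A ∪ Z) =
      commonFactor q t y M (A ∪ B) Z * splitWeight q t y A B := by
  set y' : ι → L := fun i => if i ∈ M ∪ A then q * y i else y i
  have hM : ∀ i ∈ M, y' i = q * y i := fun i hi => if_pos (Finset.mem_union_left _ hi)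
  have hA : ∀ i ∈ A, y' i = q * y i := fun i hi => if_pos (Finset.mem_union_right _ hi)
  have hB : ∀ i ∈ B, y' i = y i := fun i hi => if_neg fun h => (Finset.mem_union.1 h).elim
    (fun h => Finset.disjoint_left.1 hMB h hi) fun h => Finset.disjoint_left.1 hAB h hi
  have hZ : ∀ i ∈ Z, y' i = y i := fun i hi => if_neg fun h => (Finset.mem_union.1 h).elim
    (fun h => Finset.disjoint_left.1 hMZ h hi) fun h => Finset.disjoint_left.1 hAZ h hi
  rw [commonFactor, crossProd_union_left _ _ _ hMA, crossProd_union_left _ _ _ hMB,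
    crossProd_union_right _ _ _ _ hBZ, crossProd_union_right _ _ _ _ hBZ,
    crossProd_union_right _ _ _ _ hAZ, crossProd_union_right _ _ _ _ hAZ,
    crossProd_union_right _ _ _ _ hAB, crossProd_union_left _ _ _ hAB,
    ← crossProd_mul_crossProd, crossProd_congr hM hA, crossProd_congr hM hZ,
    crossProd_congr hB hA, crossProd_congr hB hZ,
    show crossProd t (fun i => q * y i) (fun i => q * y i) M A = crossProd t y y M A from
      Finset.prod_congr rfl fun i _ => Finset.prod_congr rfl fun j _ =>
        crossFactor_mul_left hq _ _ _]
  ring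

/-- A sum over pairs of subsets `I`, `J` vanishes if all its parts with prescribed intersection `M`
and symmetric difference `P` do. -/
theorem sum_pairs_eq_zero [Fintype ι] [DecidableEq ι] (F : Finset ι → Finset ι → L)
    (h : ∀ M P, Disjoint M P →
      ∑ A ∈ P.powerset, F (M ∪ A) (M ∪ (P \ A)) = 0) :
    ∑ I, ∑ J, F I J = 0 := by
  rw [← Fintype.sum_prod_type' F, ← Finset.sum_fiberwise _
    (fun y : Finset ι × Finset ι => (y.1 ∩ y.2, (y.1 ∪ y.2) \ (y.1 ∩ y.2)))]
  refine Finset.sum_eq_zero fun ⟨M, P⟩ _ => ?_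
  by_cases hMP : Disjoint M P
  · rw [← h M P hMP]
    refine Finset.sum_nbij' (fun y => y.1 \ M) (fun A => (M ∪ A, M ∪ (P \ A))) ?_ ?_ ?_ ?_ ?_
    · rintro ⟨I, J⟩ hy
      simp only [Finset.mem_filter, Finset.mem_univ, true_and, Prod.mk.injEq] at hy
      grind
    · intro A hA
      simp only [Finset.mem_filter, Finset.mem_univ, true_and, Prod.mk.injEq,
        Finset.mem_powerset] at hA ⊢
      have := Finset.disjoint_left.1 hMP
      constructor <;> grind
    · rintro ⟨I, J⟩ hy
      simp only [Finset.mem_filter, Finset.mem_univ, true_and, Prod.mk.injEq] at hy ⊢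
      constructor <;> grind
    · intro A hA
      have := Finset.disjoint_left.1 hMP
      simp only [Finset.mem_powerset] at hA
      grind
    · rintro ⟨I, J⟩ hy
      simp only [Finset.mem_filter, Finset.mem_univ, true_and, Prod.mk.injEq] at hy ⊢
      congr 1 <;> grind
  · refine Finset.sum_eq_zero ?_
    rintro y hy
    simp only [Finset.mem_filter, Finset.mem_univ, true_and, Prod.mk.injEq] at hy
    exact absurd (hy.1 ▸ hy.2 ▸ Finset.disjoint_sdiff) hMP

end crossProd

/-- In a field, the factors `C ((xᵢ - xⱼ)⁻¹)` become inverses of differences. -/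
theorem map_shiftCoeff {L : Type*} [Field L] (ρ : (RatFun n K)⟦X⟧ →+* L) (β : K)
    (I : Finset (Fin n)) :
    ρ (shiftCoeff β I) = crossProd (ρ (tSeries n β)) (fun i => ρ (C (x K i)))
      (fun i => ρ (C (x K i))) I Iᶜ := by
  have hinv : ∀ a : RatFun n K, ρ (C a⁻¹) = (ρ (C a))⁻¹ := fun a => map_inv₀ (ρ.comp C) a
  simp only [shiftCoeff, map_prod, crossProd, crossFactor, map_mul, map_sub, hinv, div_eq_mul_inv]

theorem DExt_D_apply (β : K) (r s : ℕ) (f : RatFun n K) :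
    DExt n β r (D n β s f) =
      tSeries n β ^ (r * (r - 1) / 2) * tSeries n β ^ (s * (s - 1) / 2) *
        ∑ I, ∑ J, if I.card = r ∧ J.card = s then
          shiftCoeff β I * shiftExt K I (shiftCoeff β J) * shiftExt K (I ∪ J) (shift K (I ∩ J) f)
        else 0 := by
  rw [DExt_apply, D_apply, mul_assoc]
  congr 1
  simp only [map_mul (shiftExt K _) (_ ^ _), map_pow, shiftExt_tSeries, map_sum, Finset.mul_sum,
    ← Finset.univ_filter_card_eq, Finset.sum_filter, ite_and]
  refine Finset.sum_congr rfl fun I _ => ?_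
  split_ifs with h
  · refine Finset.sum_congr rfl fun J _ => ?_
    split_ifs
    · rw [map_mul, shiftExt_shift I J]
      ring
    · simp
  · simp

theorem DExt_D_comm (β : K) (r s : ℕ) (f : RatFun n K) :
    DExt n β r (D n β s f) = DExt n β s (D n β r f) := by
  -- the coefficients are compared in the fraction field of the ring of power series
  let S := (RatFun n K)⟦X⟧
  let L := FractionRing S
  let q : L := algebraMap S L (qSeries n K)
  let t : L := algebraMap S L (tSeries n β)
  let y : Fin n → L := fun i => algebraMap S L (C (x K i))
  have hinjL : Function.Injective (algebraMap S L) := algebraMap_fractionRing_injective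
  have hq : q ≠ 0 := (map_ne_zero_iff _ hinjL).2 fun h => by
    simpa [h] using constantCoeff_qSeries (n := n) (K := K)
  have hy : ∀ i, y i ≠ 0 := fun i => by simpa [y] using x_ne_zero (K := K) i
  have hyinj : Function.Injective y := hinjL.comp (C_injective.comp x_injective)
  have := charZero_of_injective_algebraMap (algebraMap K (RatFun n K)).injective
  -- compare the constant coefficients first, and then the coefficients of `h`
  have h1 : ∀ i j, y i ≠ q * y j := fun i j h => by
    rw [← map_mul] at h
    replace h := hinjL h
    obtain rfl := x_injective (by simpa [constantCoeff_qSeries] using congrArg constantCoeff h)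
    have h' := congrArg (coeff 1) h
    rw [coeff_mul_C, coeff_one_qSeries] at h'
    exact x_ne_zero i (by simpa [coeff_C] using h'.symm)
  have h2 : ∀ i j, y i ≠ q * (q * y j) := fun i j h => by
    rw [← map_mul, ← map_mul, ← mul_assoc] at h
    replace h := hinjL h
    obtain rfl := x_injective (by simpa [constantCoeff_qSeries] using congrArg constantCoeff h)
    have h' := congrArg (coeff 1) h
    rw [coeff_mul_C, coeff_one_mul, constantCoeff_qSeries, coeff_one_qSeries] at h'
    norm_num [coeff_C, x_ne_zero] at h'
  have hcoeff : ∀ I J : Finset (Fin n),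
      algebraMap S L (shiftCoeff β I * shiftExt K I (shiftCoeff β J)) =
        crossProd t y y I Iᶜ * crossProd t (fun i => if i ∈ I then q * y i else y i)
          (fun i => if i ∈ I then q * y i else y i) J Jᶜ := fun I J => by
    have hx : ∀ i, algebraMap S L (shiftExt K I (C (x K i))) =
        if i ∈ I then q * y i else y i := fun i => by
      rw [shiftExt_C, shift_x]
      split_ifs
      · exact map_mul _ _ _
      · rfl
    have h := map_shiftCoeff ((algebraMap S L).comp (shiftExt K I).toRingHom) β J
    simp only [RingHom.comp_apply, AlgHom.toRingHom_eq_coe, RingHom.coe_coe, shiftExt_tSeries,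
      hx] at h
    rw [map_mul, h, map_shiftCoeff]
  -- difference of the indicator functions of the cardinalities in the two composites
  let e : ℕ → ℕ → L := fun a b =>
    (if a = r ∧ b = s then 1 else 0) - (if a = s ∧ b = r then 1 else 0)
  have hsum := sum_pairs_eq_zero (fun I J : Finset (Fin n) => e I.card J.card *
    algebraMap S L (shiftCoeff β I * shiftExt K I (shiftCoeff β J) *
      shiftExt K (I ∪ J) (shift K (I ∩ J) f))) fun M P hMP => by
    rw [← mul_zero (commonFactor q t y M P (M ∪ P)ᶜ *
      algebraMap S L (shiftExt K (M ∪ P) (shift K M f))),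
      ← sum_splitWeight_eq_zero (t := t) hq hy hyinj h1 h2 P
        (fun a b => e (M.card + a) (M.card + b))
        (fun a => by simp only [e, and_comm, sub_self])
        (fun a b => by simp only [e, neg_sub, and_comm]), Finset.mul_sum]
    refine Finset.sum_congr rfl fun A hA => ?_
    have hA' := Finset.mem_powerset.1 hA
    have hMA : Disjoint M A := hMP.mono_right hA'
    have hMB : Disjoint M (P \ A) := hMP.mono_right Finset.sdiff_subset
    have hAB : Disjoint A (P \ A) := Finset.disjoint_sdiff
    have hZ : Disjoint (M ∪ P) (M ∪ P)ᶜ := disjoint_compl_right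
    have hPZ := hZ.mono_left (Finset.subset_union_right (s₁ := M) (s₂ := P))
    have hP : A ∪ P \ A = P := Finset.union_sdiff_of_subset hA'
    have hIJ : (M ∪ A) ∪ (M ∪ P \ A) = M ∪ P := by
      rw [← Finset.union_union_distrib_left, hP]
    have hIJ' : (M ∪ A) ∩ (M ∪ P \ A) = M := by
      rw [← Finset.union_inter_distrib_left, Finset.disjoint_iff_inter_eq_empty.1 hAB,
        Finset.union_empty]
    have hI : (M ∪ A)ᶜ = P \ A ∪ (M ∪ P)ᶜ := by
      ext i
      have : i ∈ M → i ∉ P := fun h => Finset.disjoint_left.1 hMP h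
      have : i ∈ A → i ∈ P := fun h => hA' h
      simp only [Finset.mem_compl, Finset.mem_union, Finset.mem_sdiff]
      tauto
    have hJ : (M ∪ P \ A)ᶜ = A ∪ (M ∪ P)ᶜ := by
      ext i
      have : i ∈ M → i ∉ P := fun h => Finset.disjoint_left.1 hMP h
      have : i ∈ A → i ∈ P := fun h => hA' h
      simp only [Finset.mem_compl, Finset.mem_union, Finset.mem_sdiff]
      tauto
    rw [hIJ, hIJ', map_mul, hcoeff, hI, hJ, crossProd_splitting hq t y hMA hMB hAB
      (hPZ.mono_left hA') (hPZ.mono_left Finset.sdiff_subset)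
      (hZ.mono_left Finset.subset_union_left), hP, Finset.card_union_of_disjoint hMA,
      Finset.card_union_of_disjoint hMB]
    ring
  rw [DExt_D_apply, DExt_D_apply, mul_comm (tSeries n β ^ (s * (s - 1) / 2))]
  congr 1
  refine hinjL (sub_eq_zero.1 (Eq.trans ?_ hsum))
  simp only [map_sum, e, sub_mul, Finset.sum_sub_distrib]
  congr 1 <;>
  · refine Finset.sum_congr rfl fun I _ => Finset.sum_congr rfl fun J _ => ?_
    split_ifs <;> simp

end Commutation

/-! ### The substitution `h ↦ -h` -/

section Duality

open PowerSeries Finset.HasAntidiagonal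

variable {n : ℕ} {K : Type*} [Field K] [CharZero K]

theorem DExt_comm (β : K) (r s : ℕ) (φ : (RatFun n K)⟦X⟧) :
    DExt n β r (DExt n β s φ) = DExt n β s (DExt n β r φ) := by
  have h : DExt n β r ∘ₗ D n β s = DExt n β s ∘ₗ D n β r :=
    LinearMap.ext fun f => DExt_D_comm β r s f
  simp only [DExt, hExtend_hExtend]
  exact congrArg (hExtend · φ) h

/-- The substitution `h ↦ -h` in power series. -/
def negParam (K R : Type*) [CommRing K] [CommRing R] [Algebra K R] : R⟦X⟧ →ₐ[K] R⟦X⟧ :=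
  { rescale (-1 : R) with
    commutes' := fun c => by
      ext k
      by_cases h : k = 0 <;> simp [PowerSeries.algebraMap_apply, coeff_C, h] }

theorem negParam_apply {K R : Type*} [CommRing K] [CommRing R] [Algebra K R] (φ : R⟦X⟧) :
    negParam K R φ = rescale (-1) φ := rfl

theorem coeff_negParam {K R : Type*} [CommRing K] [CommRing R] [Algebra K R] (k : ℕ) (φ : R⟦X⟧) :
    coeff k (negParam K R φ) = (-1) ^ k * coeff k φ := by
  rw [negParam_apply, coeff_rescale]

theorem negParam_C {K R : Type*} [CommRing K] [CommRing R] [Algebra K R] (f : R) :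
    negParam K R (C f) = C f := by
  ext k
  rw [coeff_negParam, coeff_C]
  split_ifs with h <;> simp [h]

theorem negParam_map {K R : Type*} [CommRing K] [CommRing R] [Algebra K R] (φ : K⟦X⟧) :
    negParam K R (PowerSeries.map (algebraMap K R) φ) =
      PowerSeries.map (algebraMap K R) (rescale (-1) φ) := by
  ext k
  simp [coeff_negParam, coeff_rescale]

theorem exp_mul_rescale_neg_one_exp : rescale (-1) (exp K) * exp K = 1 := by
  rw [mul_comm]
  exact exp_mul_exp_neg_eq_one

theorem negParam_qSeries_mul :
    negParam K (RatFun n K) (qSeries n K) * qSeries n K = 1 := by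
  rw [qSeries, negParam_map, ← map_mul, exp_mul_rescale_neg_one_exp, map_one]

theorem negParam_tSeries_mul (β : K) :
    negParam K (RatFun n K) (tSeries n β) * tSeries n β = 1 := by
  rw [tSeries, negParam_map, ← map_mul, rescale_rescale, mul_comm β, ← rescale_rescale,
    ← map_mul (rescale β), exp_mul_rescale_neg_one_exp, map_one, map_one]

/-- The inverse of the simultaneous shift of all variables: `xᵢ ↦ q⁻¹ xᵢ` for all `i`. -/
def invShift (n : ℕ) (K : Type*) [Field K] [CharZero K] : RatFun n K →ₐ[K] (RatFun n K)⟦X⟧ :=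
  (negParam K (RatFun n K)).comp (shift K Finset.univ)

theorem invShift_x (i : Fin n) :
    invShift n K (x K i) = negParam K (RatFun n K) (qSeries n K) * C (x K i) := by
  simp [invShift, shift_x, negParam_C]

theorem hExtendAlg_negParam_qSeries (T : RatFun n K →ₐ[K] (RatFun n K)⟦X⟧) :
    hExtendAlg T (negParam K (RatFun n K) (qSeries n K)) =
      negParam K (RatFun n K) (qSeries n K) := by
  rw [qSeries, negParam_map, hExtendAlg_map_algebraMap]

/-- Shifting the variables in `J` back amounts to shifting all variables back, and then those
outside `J` forward. -/
theorem negParam_shift (J : Finset (Fin n)) (f : RatFun n K) :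
    negParam K (RatFun n K) (shift K J f) = shiftExt K Jᶜ (invShift n K f) := by
  suffices h : (negParam K (RatFun n K)).comp (shift K J) =
      (shiftExt K Jᶜ).comp (invShift n K) from DFunLike.congr_fun h f
  refine RatFun.algHom_ext fun i => ?_
  rw [AlgHom.comp_apply, AlgHom.comp_apply, invShift_x, map_mul, shiftExt_C, shift_x, shift_x,
    shiftExt, hExtendAlg_negParam_qSeries]
  by_cases hi : i ∈ J
  · simp [hi, negParam_C]
  · simp [hi, negParam_C, ← mul_assoc, negParam_qSeries_mul]

theorem hExtendAlg_invShift_shift (I : Finset (Fin n)) (f : RatFun n K) :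
    hExtendAlg (invShift n K) (shift K I f) = shiftExt K I (invShift n K f) := by
  suffices h : (hExtendAlg (invShift n K)).comp (shift K I) =
      (shiftExt K I).comp (invShift n K) from DFunLike.congr_fun h f
  refine RatFun.algHom_ext fun i => ?_
  have hq : hExtendAlg (invShift n K) (qSeries n K) = qSeries n K := hExtendAlg_map_algebraMap _ _
  rw [AlgHom.comp_apply, AlgHom.comp_apply, invShift_x, map_mul, shiftExt_C, shift_x,
    shiftExt, hExtendAlg_negParam_qSeries]
  split_ifs
  · rw [map_mul, hExtendAlg_C, invShift_x, hq]
    ring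
  · rw [hExtendAlg_C, invShift_x]

/-- The coefficients of the Macdonald operators are homogeneous of degree zero. -/
theorem hExtendAlg_invShift_shiftCoeff (β : K) (I : Finset (Fin n)) :
    hExtendAlg (invShift n K) (shiftCoeff β I) = shiftCoeff β I := by
  refine algebraMap_fractionRing_injective ?_
  have h := map_shiftCoeff ((algebraMap _ (FractionRing (RatFun n K)⟦X⟧)).comp
    (hExtendAlg (invShift n K)).toRingHom) β I
  have ht : hExtendAlg (invShift n K) (tSeries n β) = tSeries n β := hExtendAlg_map_algebraMap _ _
  have hq : algebraMap _ (FractionRing (RatFun n K)⟦X⟧)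
      (negParam K (RatFun n K) (qSeries n K)) ≠ 0 :=
    (map_ne_zero_iff _ algebraMap_fractionRing_injective).2
      (left_ne_zero_of_mul_eq_one negParam_qSeries_mul)
  simp only [RingHom.comp_apply, AlgHom.toRingHom_eq_coe, RingHom.coe_coe, ht, hExtendAlg_C,
    invShift_x, map_mul] at h
  rw [h, map_shiftCoeff]
  exact Finset.prod_congr rfl fun i _ => Finset.prod_congr rfl fun j _ =>
    crossFactor_mul_left hq _ _ _

theorem crossFactor_inv {L : Type*} [Field L] {t t' : L} (h : t' * t = 1) (a b : L) :
    crossFactor t' a b = t' * crossFactor t b a := by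
  rw [crossFactor, crossFactor, ← neg_sub a b, ← neg_sub a (t * b), neg_div_neg_eq, mul_div_assoc',
    mul_sub, ← mul_assoc, h, one_mul]

theorem negParam_shiftCoeff (β : K) {J : Finset (Fin n)} {s : ℕ} (hJ : J.card = s) :
    negParam K (RatFun n K) (shiftCoeff β J) =
      negParam K (RatFun n K) (tSeries n β) ^ (s * (n - s)) * shiftCoeff β Jᶜ := by
  refine algebraMap_fractionRing_injective ?_
  have h := map_shiftCoeff ((algebraMap _ (FractionRing (RatFun n K)⟦X⟧)).comp
    (negParam K (RatFun n K)).toRingHom) β J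
  simp only [RingHom.comp_apply, AlgHom.toRingHom_eq_coe, RingHom.coe_coe, negParam_C] at h
  have ht : algebraMap _ (FractionRing (RatFun n K)⟦X⟧) (negParam K (RatFun n K) (tSeries n β)) *
      algebraMap _ (FractionRing (RatFun n K)⟦X⟧) (tSeries n β) = 1 := by
    rw [← map_mul, negParam_tSeries_mul, map_one]
  have hJ' : Jᶜ.card = n - s := by rw [Finset.card_compl, Fintype.card_fin, hJ]
  rw [h, map_mul, map_pow, map_shiftCoeff, compl_compl, crossProd, crossProd,
    Finset.prod_comm (s := Jᶜ)]
  simp only [crossFactor_inv ht, Finset.prod_mul_distrib, Finset.prod_const, hJ', hJ]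
  rw [← pow_mul, mul_comm s]

/-- The Macdonald operator `D_n^s` at `-h` is a constant times `D_n^{n-s}` at `h`, applied after the
inverse shift of all variables. -/
theorem exists_negParam_D (β : K) {s : ℕ} (hs : s ≤ n) :
    ∃ c : K⟦X⟧, ∀ f, negParam K (RatFun n K) (D n β s f) =
      PowerSeries.map (algebraMap K (RatFun n K)) c * DExt n β (n - s) (invShift n K f) := by
  let τ : K⟦X⟧ := rescale (-1) (rescale β (exp K))
  have hτ : negParam K (RatFun n K) (tSeries n β) = PowerSeries.map (algebraMap K _) τ :=
    negParam_map _
  refine ⟨τ ^ (s * (s - 1) / 2) * τ ^ (s * (n - s)) * τ ^ ((n - s) * (n - s - 1) / 2), fun f => ?_⟩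
  have hcancel : negParam K (RatFun n K) (tSeries n β) ^ ((n - s) * (n - s - 1) / 2) *
      tSeries n β ^ ((n - s) * (n - s - 1) / 2) = 1 := by
    rw [← mul_pow, negParam_tSeries_mul, one_pow]
  rw [D_apply, DExt_apply, map_mul, map_mul, map_mul, map_pow, map_pow, map_pow, map_pow, ← hτ,
    mul_assoc, mul_assoc, ← mul_assoc (_ ^ ((n - s) * _ / 2)), hcancel, one_mul]
  congr 1
  rw [map_sum, Finset.mul_sum]
  refine Finset.sum_nbij' (fun J : Finset (Fin n) => Jᶜ) (fun J : Finset (Fin n) => Jᶜ) ?_ ?_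
    (fun J _ => compl_compl J) (fun J _ => compl_compl J) fun J hJ => ?_
  · intro J hJ
    rw [Finset.mem_powersetCard_univ] at hJ ⊢
    rw [Finset.card_compl, Fintype.card_fin, hJ]
  · intro J hJ
    rw [Finset.mem_powersetCard_univ] at hJ ⊢
    rw [Finset.card_compl, Fintype.card_fin, hJ, Nat.sub_sub_self hs]
  · rw [Finset.mem_powersetCard_univ] at hJ
    rw [map_mul, negParam_shiftCoeff β hJ, negParam_shift, mul_assoc]

theorem DExt_invShift (β : K) (r : ℕ) (f : RatFun n K) :
    DExt n β r (invShift n K f) = hExtendAlg (invShift n K) (D n β r f) := by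
  have ht : hExtendAlg (invShift n K) (tSeries n β) = tSeries n β := hExtendAlg_map_algebraMap _ _
  simp only [DExt_apply, D_apply, map_mul, map_pow, map_sum, ht, hExtendAlg_invShift_shiftCoeff,
    hExtendAlg_invShift_shift]

/-- `D_n^r` at `h` commutes with `D_n^s` at `-h`. -/
theorem DExt_negParam_D (β : K) (r : ℕ) {s : ℕ} (hs : s ≤ n) (f : RatFun n K) :
    DExt n β r (negParam K (RatFun n K) (D n β s f)) =
      hExtend ((negParam K (RatFun n K)).toLinearMap ∘ₗ D n β s) (D n β r f) := by
  obtain ⟨c, hc⟩ := exists_negParam_D β hs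
  have h : (negParam K (RatFun n K)).toLinearMap ∘ₗ D n β s =
      LinearMap.mulLeft K (PowerSeries.map (algebraMap K (RatFun n K)) c) ∘ₗ
        (DExt n β (n - s) ∘ₗ (invShift n K).toLinearMap) := LinearMap.ext hc
  rw [h, hExtend_mulLeft_comp, DExt_eq β (n - s), ← hExtend_hExtend, ← DExt_eq,
    ← hExtendAlg_apply, ← DExt_invShift, ← DExt_comm, hc, DExt_eq β r,
    hExtend_map_algebraMap_mul]

theorem sum_order_comm (β : K) (r s k : ℕ) (f : RatFun n K) :
    ∑ ab ∈ antidiagonal k, (order n β r ab.1 (order n β s ab.2 f) -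
      order n β s ab.2 (order n β r ab.1 f)) = 0 := by
  rw [Finset.sum_sub_distrib, sub_eq_zero, ← coeff_DExt_D, DExt_D_comm, coeff_DExt_D,
    ← Finset.Nat.sum_antidiagonal_swap]
  rfl

theorem sum_neg_one_pow_order_comm (β : K) (r : ℕ) {s : ℕ} (hs : s ≤ n) (k : ℕ)
    (f : RatFun n K) :
    ∑ ab ∈ antidiagonal k, (-1) ^ ab.2 * (order n β r ab.1 (order n β s ab.2 f) -
      order n β s ab.2 (order n β r ab.1 f)) = 0 := by
  have h := congrArg (coeff k) (DExt_negParam_D β r hs f)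
  rw [DExt, coeff_hExtend, coeff_hExtend] at h
  rw [← sub_eq_zero, ← Finset.Nat.sum_antidiagonal_swap (f := fun ab => coeff ab.1
    (((negParam K (RatFun n K)).toLinearMap ∘ₗ D n β s) _)), ← Finset.sum_sub_distrib] at h
  rw [← h]
  refine Finset.sum_congr rfl fun ab _ => ?_
  have hneg : ∀ f : RatFun n K, (-1) ^ ab.2 * f = (-1 : K) ^ ab.2 • f := fun f => by
    rw [Algebra.smul_def, map_pow, map_neg, map_one]
  simp only [LinearMap.comp_apply, AlgHom.toLinearMap_apply, coeff_negParam, Prod.fst_swap, hneg,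
    map_smul, PowerSeries.coeff_smul, smul_sub]
  rfl

end Duality

/-! ### The terms of order at most one -/

section Euler

open PowerSeries Finset.HasAntidiagonal

variable {n : ℕ} {K : Type*} [Field K]

/-- Two derivations along an algebra homomorphism `T` that agree on the variables are equal. -/
theorem RatFun.eq_of_leibniz {A : Type*} [CommRing A] [Algebra K A] (T : RatFun n K →ₐ[K] A)
    {δ δ' : RatFun n K →ₗ[K] A} (h : ∀ f g, δ (f * g) = T f * δ g + T g * δ f)
    (h' : ∀ f g, δ' (f * g) = T f * δ' g + T g * δ' f) (hx : ∀ i, δ (x K i) = δ' (x K i)) :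
    δ = δ' := by
  have h1 : δ 1 = 0 := by simpa using h 1 1
  have h1' : δ' 1 = 0 := by simpa using h' 1 1
  have hpoly : ∀ p : MvPolynomial (Fin n) K,
      δ (algebraMap _ (RatFun n K) p) = δ' (algebraMap _ (RatFun n K) p) := fun p => by
    induction p using MvPolynomial.induction_on with
    | C a =>
      rw [← MvPolynomial.algebraMap_eq, ← IsScalarTower.algebraMap_apply,
        Algebra.algebraMap_eq_smul_one, map_smul, map_smul, h1, h1']
    | add p q hp hq => rw [map_add, map_add, map_add, hp, hq]
    | mul_X p i hp =>
      rw [map_mul, h, h', hp]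
      exact congrArg₂ _ (congrArg _ (hx i)) rfl
  refine LinearMap.ext fun f => ?_
  obtain ⟨p, q, hq, rfl⟩ := IsFractionRing.div_surjective (A := MvPolynomial (Fin n) K) f
  have hq0 : algebraMap _ (RatFun n K) q ≠ 0 :=
    IsFractionRing.to_map_ne_zero_of_mem_nonZeroDivisors hq
  have hp := hpoly p
  rw [← div_mul_cancel₀ (algebraMap _ (RatFun n K) p) hq0, h, h', hpoly q] at hp
  exact ((IsUnit.mk0 _ hq0).map T).mul_left_cancel (add_left_cancel hp)

variable [CharZero K]

theorem constantCoeff_shift (I : Finset (Fin n)) (f : RatFun n K) :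
    constantCoeff (shift K I f) = f := by
  let ε : (RatFun n K)⟦X⟧ →ₐ[K] RatFun n K :=
    { constantCoeff with commutes' := fun c => by simp [PowerSeries.algebraMap_apply] }
  suffices h : ε.comp (shift K I) = AlgHom.id K _ from DFunLike.congr_fun h f
  refine RatFun.algHom_ext fun i => ?_
  change constantCoeff (shift K I (x K i)) = x K i
  rw [shift_x]
  split_ifs <;> simp [constantCoeff_qSeries]

/-- The derivation `∑_{i ∈ I} xᵢ ∂/∂xᵢ`, obtained as the coefficient of `h` in the shift of the
variables in `I`. -/
def shiftDeriv (K : Type*) [Field K] [CharZero K] (I : Finset (Fin n)) :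
    Derivation K (RatFun n K) (RatFun n K) :=
  Derivation.mk'
    { toFun := fun f => coeff 1 (shift K I f)
      map_add' := fun f g => by simp
      map_smul' := fun c f => by rw [map_smul, PowerSeries.coeff_smul, RingHom.id_apply] }
    fun f g => by
      simp only [LinearMap.coe_mk, AddHom.coe_mk, map_mul, coeff_one_mul, constantCoeff_shift,
        smul_eq_mul]
      ring

theorem shiftDeriv_apply (I : Finset (Fin n)) (f : RatFun n K) :
    shiftDeriv K I f = coeff 1 (shift K I f) := rfl

theorem shiftDeriv_x (I : Finset (Fin n)) (i : Fin n) :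
    shiftDeriv K I (x K i) = if i ∈ I then x K i else 0 := by
  rw [shiftDeriv_apply, shift_x]
  split_ifs
  · rw [coeff_mul_C, coeff_one_qSeries, one_mul]
  · simp

/-- The Euler operator `∑ xᵢ ∂/∂xᵢ`. -/
abbrev euler (n : ℕ) (K : Type*) [Field K] [CharZero K] :
    Derivation K (RatFun n K) (RatFun n K) :=
  shiftDeriv K Finset.univ

theorem euler_x (i : Fin n) : euler n K (x K i) = x K i := by simp [shiftDeriv_x]

/-- A derivation, applied to each coefficient of a power series. -/
def coeffwise {K R : Type*} [CommRing K] [CommRing R] [Algebra K R] (δ : Derivation K R R) :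
    Derivation K R⟦X⟧ R⟦X⟧ :=
  Derivation.mk'
    { toFun := fun φ => PowerSeries.mk fun k => δ (coeff k φ)
      map_add' := fun φ ψ => by ext k; simp
      map_smul' := fun c φ => by ext k; simp }
    fun φ ψ => by
      ext k
      simp only [LinearMap.coe_mk, AddHom.coe_mk, coeff_mk, smul_eq_mul, map_add, coeff_mul,
        map_sum, Derivation.leibniz, Finset.sum_add_distrib]
      congr 1
      rw [← Finset.Nat.sum_antidiagonal_swap]
      rfl

theorem coeff_coeffwise {K R : Type*} [CommRing K] [CommRing R] [Algebra K R]
    (δ : Derivation K R R) (k : ℕ) (φ : R⟦X⟧) :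
    coeff k (coeffwise δ φ) = δ (coeff k φ) := by
  simp [coeffwise]

theorem coeffwise_C {K R : Type*} [CommRing K] [CommRing R] [Algebra K R]
    (δ : Derivation K R R) (f : R) : coeffwise δ (C f) = C (δ f) := by
  ext k
  rw [coeff_coeffwise, coeff_C, coeff_C]
  split_ifs <;> simp

theorem coeffwise_map {K R : Type*} [CommRing K] [CommRing R] [Algebra K R]
    (δ : Derivation K R R) (φ : K⟦X⟧) :
    coeffwise δ (PowerSeries.map (algebraMap K R) φ) = 0 := by
  ext k
  simp [coeff_coeffwise]

theorem coeffwise_euler_shift (I : Finset (Fin n)) (f : RatFun n K) :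
    coeffwise (euler n K) (shift K I f) = shift K I (euler n K f) := by
  refine DFunLike.congr_fun (RatFun.eq_of_leibniz (shift K I)
    (δ := (coeffwise (euler n K)).toLinearMap ∘ₗ (shift K I).toLinearMap)
    (δ' := (shift K I).toLinearMap ∘ₗ (euler n K).toLinearMap) (fun f g => ?_) (fun f g => ?_)
    fun i => ?_) f
  · simp
  · simp
  · change coeffwise (euler n K) (shift K I (x K i)) = shift K I (euler n K (x K i))
    have hq : coeffwise (euler n K) (qSeries n K) = 0 := coeffwise_map _ _
    rw [euler_x, shift_x]
    split_ifs
    · rw [Derivation.leibniz, hq, coeffwise_C, euler_x]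
      simp
    · rw [coeffwise_C, euler_x]

theorem derivation_prod_eq_zero {R A ι : Type*} [CommSemiring R] [CommSemiring A] [Algebra R A]
    (δ : Derivation R A A) (s : Finset ι) (f : ι → A) (h : ∀ i ∈ s, δ (f i) = 0) :
    δ (∏ i ∈ s, f i) = 0 :=
  Finset.prod_induction f (fun a => δ a = 0) (fun a b ha hb => by simp [ha, hb])
    (Derivation.map_one_eq_zero δ) h

theorem coeffwise_euler_shiftCoeff (β : K) (I : Finset (Fin n)) :
    coeffwise (euler n K) (shiftCoeff β I) = 0 := by
  refine derivation_prod_eq_zero _ _ _ fun i hi => derivation_prod_eq_zero _ _ _ fun j hj => ?_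
  have hne : x K i - x K j ≠ 0 := sub_ne_zero.2 fun h =>
    Finset.mem_compl.1 hj (x_injective h ▸ hi)
  have ht : coeffwise (euler n K) (tSeries n β) = 0 := coeffwise_map _ _
  have hE : euler n K (x K i - x K j)⁻¹ = -(x K i - x K j)⁻¹ := by
    rw [Derivation.leibniz_inv, map_sub, euler_x, euler_x, smul_eq_mul]
    field_simp
  rw [Derivation.leibniz, map_sub, Derivation.leibniz, ht, coeffwise_C, coeffwise_C, coeffwise_C,
    hE, euler_x, euler_x, map_neg]
  simp only [smul_eq_mul]
  ring

theorem coeffwise_euler_D (β : K) (r : ℕ) (f : RatFun n K) :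
    coeffwise (euler n K) (D n β r f) = D n β r (euler n K f) := by
  have ht : coeffwise (euler n K) (tSeries n β) = 0 := coeffwise_map _ _
  simp [D_apply, coeffwise_euler_shiftCoeff, coeffwise_euler_shift, Derivation.leibniz_pow, ht]

theorem euler_order (β : K) (r k : ℕ) (f : RatFun n K) :
    euler n K (order n β r k f) = order n β r k (euler n K f) := by
  have h := congrArg (coeff k) (coeffwise_euler_D β r f)
  rwa [coeff_coeffwise] at h

theorem coeff_one_prod {R ι : Type*} [CommRing R] (s : Finset ι) (φ : ι → R⟦X⟧)
    (h : ∀ i ∈ s, constantCoeff (φ i) = 1) :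
    constantCoeff (∏ i ∈ s, φ i) = 1 ∧ coeff 1 (∏ i ∈ s, φ i) = ∑ i ∈ s, coeff 1 (φ i) := by
  classical
  induction s using Finset.induction_on with
  | empty => simp [coeff_one]
  | insert a s ha ih =>
    obtain ⟨ih0, ih1⟩ := ih fun i hi => h i (Finset.mem_insert_of_mem hi)
    have h0 := h a (Finset.mem_insert_self _ _)
    rw [Finset.prod_insert ha, Finset.sum_insert ha, map_mul, coeff_one_mul, h0, ih0, ih1]
    simp

theorem constantCoeff_tSeries (β : K) : constantCoeff (tSeries n β) = 1 := by
  rw [← coeff_zero_eq_constantCoeff_apply]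
  simp [tSeries, coeff_rescale]

theorem coeff_one_tSeries (β : K) : coeff 1 (tSeries n β) = algebraMap K _ β := by
  simp [tSeries, coeff_rescale, coeff_exp]

theorem coeff_shiftCoeff (β : K) (I : Finset (Fin n)) :
    constantCoeff (shiftCoeff β I) = 1 ∧
      coeff 1 (shiftCoeff β I) =
        ∑ i ∈ I, ∑ j ∈ Iᶜ, algebraMap K _ β * (x K i * (x K i - x K j)⁻¹) := by
  have h : ∀ i ∈ I, ∀ j ∈ Iᶜ, constantCoeff
      ((tSeries n β * C (x K i) - C (x K j)) * C ((x K i - x K j)⁻¹)) = 1 := fun i hi j hj => by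
    simp only [map_mul, map_sub, constantCoeff_tSeries, constantCoeff_C, one_mul]
    exact mul_inv_cancel₀ (sub_ne_zero.2 fun h => Finset.mem_compl.1 hj (x_injective h ▸ hi))
  obtain ⟨h0, h1⟩ := coeff_one_prod I
    (fun i => ∏ j ∈ Iᶜ, (tSeries n β * C (x K i) - C (x K j)) * C ((x K i - x K j)⁻¹))
    fun i hi => (coeff_one_prod _ _ (h i hi)).1
  refine ⟨h0, h1.trans (Finset.sum_congr rfl fun i hi => (coeff_one_prod _ _ (h i hi)).2.trans
    (Finset.sum_congr rfl fun j hj => ?_))⟩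
  rw [coeff_mul_C, map_sub, coeff_mul_C, coeff_one_tSeries]
  simp [mul_assoc]

theorem order_zero (β : K) (r : ℕ) (f : RatFun n K) :
    order n β r 0 f = ((n.choose r : ℕ) : K) • f := by
  change coeff 0 (D n β r f) = _
  simp [D_apply, constantCoeff_tSeries, (coeff_shiftCoeff β _).1, constantCoeff_shift,
    Algebra.smul_def]

theorem sum_powersetCard_map {M : Type*} [AddCommMonoid M] (σ : Equiv.Perm (Fin n)) (r : ℕ)
    (g : Finset (Fin n) → M) :
    ∑ I ∈ Finset.powersetCard r Finset.univ, g (I.map σ.toEmbedding) =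
      ∑ I ∈ Finset.powersetCard r Finset.univ, g I :=
  Finset.sum_equiv σ.finsetCongr (by simp) (by simp)

/-- Each variable lies in the same number of subsets of cardinality `r`. -/
theorem exists_sum_shiftDeriv (r : ℕ) :
    ∃ a : K, ∀ f : RatFun n K,
      ∑ I ∈ Finset.powersetCard r Finset.univ, shiftDeriv K I f = a • euler n K f := by
  let N : Fin n → ℕ := fun i =>
    ∑ I ∈ Finset.powersetCard r (Finset.univ : Finset (Fin n)), if i ∈ I then 1 else 0
  have hN : ∀ i j, N i = N j := fun i j => by
    simp only [N]
    rw [← sum_powersetCard_map (Equiv.swap i j)]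
    simp [Finset.mem_map_equiv]
  obtain ⟨a, ha⟩ : ∃ a : ℕ, ∀ i, N i = a := by
    obtain h | ⟨⟨i⟩⟩ := isEmpty_or_nonempty (Fin n)
    · exact ⟨0, fun i => (h.false i).elim⟩
    · exact ⟨N i, fun j => hN j i⟩
  refine ⟨a, fun f => ?_⟩
  have h := RatFun.eq_of_leibniz (AlgHom.id K (RatFun n K))
    (δ := ∑ I ∈ Finset.powersetCard r Finset.univ, (shiftDeriv K I).toLinearMap)
    (δ' := (a : K) • (euler n K).toLinearMap)
    (fun f g => by simp [LinearMap.sum_apply, Finset.sum_add_distrib, Finset.mul_sum])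
    (fun f g => by simp [Algebra.smul_def]; ring) fun i => by
      simp [LinearMap.sum_apply, shiftDeriv_x, Algebra.smul_def, ← ha i, N, ← Finset.sum_filter]
  simpa [LinearMap.sum_apply] using DFunLike.congr_fun h f

/-- The coefficients of `h` in the `shiftCoeff`s are not constant, but their sum is: the fractions
`xᵢ / (xᵢ - xⱼ)` and `xⱼ / (xⱼ - xᵢ)` occur in it equally often, and add up to `1`. -/
theorem exists_sum_coeff_shiftCoeff (β : K) (r : ℕ) :
    ∃ a : K, ∑ I ∈ Finset.powersetCard r (Finset.univ : Finset (Fin n)),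
      coeff 1 (shiftCoeff β I) = algebraMap K (RatFun n K) a := by
  let N : Fin n → Fin n → ℕ := fun i j =>
    ∑ I ∈ Finset.powersetCard r (Finset.univ : Finset (Fin n)), if i ∈ I ∧ j ∉ I then 1 else 0
  have hN : ∀ i j, N i j = N j i := fun i j => by
    simp only [N]
    rw [← sum_powersetCard_map (Equiv.swap i j)]
    simp [Finset.mem_map_equiv]
  let u : Fin n → Fin n → RatFun n K := fun i j => x K i * (x K i - x K j)⁻¹
  have hu : ∀ i j, u i j + u j i = if i = j then 0 else 1 := fun i j => by
    simp only [u]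
    split_ifs with h
    · simp [h]
    · have h1 := sub_ne_zero.2 fun h' => h (x_injective (K := K) h')
      rw [← neg_sub (x K i) (x K j), inv_neg, mul_neg, ← sub_eq_add_neg, ← sub_mul,
        mul_inv_cancel₀ h1]
  have hsum : ∑ I ∈ Finset.powersetCard r (Finset.univ : Finset (Fin n)),
      coeff 1 (shiftCoeff β I) = algebraMap K _ β * ∑ i, ∑ j, N i j * u i j := by
    have hI : ∀ I : Finset (Fin n), coeff 1 (shiftCoeff β I) =
        algebraMap K _ β * ∑ i, ∑ j, if i ∈ I ∧ j ∉ I then u i j else 0 := fun I => by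
      rw [(coeff_shiftCoeff β I).2]
      simp only [u, ← Finset.mul_sum, ite_and, ← Finset.mem_compl, Finset.sum_ite_irrel,
        Finset.sum_const_zero, Finset.sum_ite_mem, Finset.univ_inter]
    simp only [hI, ← Finset.mul_sum]
    rw [Finset.sum_comm]
    congr 1
    refine Finset.sum_congr rfl fun i _ => ?_
    rw [Finset.sum_comm]
    refine Finset.sum_congr rfl fun j _ => ?_
    simp [N, ← Finset.sum_filter]
  have hdouble : ∑ i, ∑ j, N i j * u i j + ∑ i, ∑ j, N i j * u i j =
      ∑ i, ∑ j, (N i j : RatFun n K) * (if i = j then 0 else 1) := by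
    nth_rw 2 [Finset.sum_comm]
    simp only [← Finset.sum_add_distrib]
    refine Finset.sum_congr rfl fun i _ => Finset.sum_congr rfl fun j _ => ?_
    rw [hN j i, ← mul_add, hu]
  have := charZero_of_injective_algebraMap (algebraMap K (RatFun n K)).injective
  refine ⟨β * (2⁻¹ * ∑ i, ∑ j, (N i j : K) * (if i = j then 0 else 1)), ?_⟩
  rw [hsum, map_mul, map_mul, map_inv₀]
  simp only [map_sum, map_mul, map_natCast, apply_ite (algebraMap K (RatFun n K)), map_zero,
    map_one, map_ofNat, ← hdouble]
  ring

theorem exists_order_one (β : K) (r : ℕ) :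
    ∃ a b : K, ∀ f : RatFun n K, order n β r 1 f = a • euler n K f + b • f := by
  obtain ⟨a, ha⟩ := exists_sum_shiftDeriv (n := n) (K := K) r
  obtain ⟨b, hb⟩ := exists_sum_coeff_shiftCoeff (n := n) β r
  refine ⟨a, ((r * (r - 1) / 2 : ℕ) : K) * β * (n.choose r : ℕ) + b, fun f => ?_⟩
  change coeff 1 (D n β r f) = _
  have hpow : constantCoeff (tSeries n β ^ (r * (r - 1) / 2)) = 1 := by
    rw [map_pow, constantCoeff_tSeries, one_pow]
  have hpow' : coeff 1 (tSeries n β ^ (r * (r - 1) / 2)) =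
      ((r * (r - 1) / 2 : ℕ) : RatFun n K) * algebraMap K _ β := by
    have h := (coeff_one_prod (Finset.range (r * (r - 1) / 2)) (fun _ => tSeries n β)
      fun _ _ => constantCoeff_tSeries β).2
    simpa [coeff_one_tSeries] using h
  rw [D_apply, coeff_one_mul, hpow, hpow']
  simp only [map_sum, map_mul, coeff_one_mul, constantCoeff_shift, (coeff_shiftCoeff β _).1,
    ← shiftDeriv_apply, Finset.sum_add_distrib, ← Finset.sum_mul, hb, one_mul, mul_one, ha]
  simp [Algebra.smul_def]
  ring

theorem order_one_comm (β : K) (r s k : ℕ) (f : RatFun n K) :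
    order n β r 1 (order n β s k f) = order n β s k (order n β r 1 f) := by
  obtain ⟨a, b, h⟩ := exists_order_one (n := n) β r
  rw [h, h, euler_order, map_add, map_smul, map_smul]

theorem order_zero_comm (β : K) (r s k : ℕ) (f : RatFun n K) :
    order n β r 0 (order n β s k f) = order n β s k (order n β r 0 f) := by
  rw [order_zero, order_zero, map_smul]

end Euler

end Macdonald

end

theorem mainTheorem2 {K : Type*} [Field K] [CharZero K] (β : K) (n r s i j : ℕ)
    (hr : 1 ≤ r) (hrn : r ≤ n) (hs : 1 ≤ s) (hsn : s ≤ n) (hi : i ≤ 3) (hj : j ≤ 3)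
    (f : Macdonald.RatFun n K) (hf : Macdonald.IsSymmetric f) :
    Macdonald.order n β r i (Macdonald.order n β s j f) =
      Macdonald.order n β s j (Macdonald.order n β r i f) := by
  have := charZero_of_injective_algebraMap (algebraMap K (Macdonald.RatFun n K)).injective
  set c : ℕ → ℕ → Macdonald.RatFun n K := fun a b =>
    Macdonald.order n β r a (Macdonald.order n β s b f) -
      Macdonald.order n β s b (Macdonald.order n β r a f)
  have h0 : ∀ b, c 0 b = 0 := fun b => sub_eq_zero.2 (Macdonald.order_zero_comm β r s b f)
  have h0' : ∀ a, c a 0 = 0 := fun a => sub_eq_zero.2 (Macdonald.order_zero_comm β s r a f).symm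
  have h1 : ∀ b, c 1 b = 0 := fun b => sub_eq_zero.2 (Macdonald.order_one_comm β r s b f)
  have h1' : ∀ a, c a 1 = 0 := fun a => sub_eq_zero.2 (Macdonald.order_one_comm β s r a f).symm
  have hsum : ∀ k, ∑ ab ∈ Finset.HasAntidiagonal.antidiagonal k, c ab.1 ab.2 = 0 := fun k =>
    Macdonald.sum_order_comm β r s k f
  have hsum' : ∀ k, ∑ ab ∈ Finset.HasAntidiagonal.antidiagonal k, (-1) ^ ab.2 * c ab.1 ab.2 = 0 :=
    fun k => Macdonald.sum_neg_one_pow_order_comm β r hsn k f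
  -- `hsum` and `hsum'` without the terms that vanish by `h0`, `h0'`, `h1` and `h1'`
  have h4 := hsum 4
  have h5 := hsum 5
  have h5' := hsum' 5
  have h6 := hsum 6
  have h6' := hsum' 6
  simp only [Finset.Nat.sum_antidiagonal_eq_sum_range_succ_mk, Finset.sum_range_succ,
    Finset.sum_range_zero, Nat.reduceSub, h0, h0', h1, h1'] at h4 h5 h5' h6 h6'
  refine sub_eq_zero.1 (?_ : c i j = 0)
  interval_cases i
  · exact h0 j
  · exact h1 j
  all_goals interval_cases j
  · exact h0' 2
  · exact h1' 2
  · linear_combination h4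
  · linear_combination (h5 - h5') / 2
  · exact h0' 3
  · exact h1' 3
  · linear_combination (h5 + h5') / 2
  · linear_combination (h6 - h6') / 2
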